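/- \textbf{Model.} The typical user is at the origin, the centre of a disc of radius $\varrho\in(0,\infty)$ in the plane. Three independent homogeneous Poisson point processes on the disc describe the base stations: the F-APs that cache the requested content ($F_c$, density $p_{hit}\lambda_F$, power $P_F$), the F-APs that do not ($\tilde F_c$, density $(1-p_{hit})\lambda_F$, power $P_F$) and the RRHs ($R$, density $\lambda_R$, power $P_R$), with $\lambda_F,\lambda_R,P_F,P_R>0$. Here $p_{hit}=\sum_{i=1}^{M}i^{-\tau}/\sum_{i=1}^{N}i^{-\tau}$ with $M<N$ and $\tau\ge 0$. A station at distance $r$ is received with power $S=P|h|^2r^{-\alpha}$, where $\alpha>2$ and the gains $|h|^2$ are independent (also of the positions) and exponential with mean $1$. The noise power is $\sigma^2>0$. The SINR of an F-AP $x$ is $S_x/(\sum_{y\ne x}S_y+\sigma^2)$, the sum being over all other stations. The SINR of an RRH $x$ is $\zeta S_x/(\sum_{y\in\text{F-APs}}S_y+\upsilon\sum_{y\in\text{RRHs},\,y\ne x}S_y+\sigma^2)$, where, for $B$ feedback bits and $N_B\ge 2$ antennas, $\zeta=1-2^B\,\mathrm{Beta}\bigl(2^B,\tfrac{N_B}{N_B-1}\bigr)$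 and $\upsilon=2^{-B/(N_B-1)}$. The instantaneous rate of $x$ is $R_x=\log_2(1+\mathrm{SINR}_x)$. \textbf{Latencies.} Let $L>0$ be the content length, $\xi>0$ the request rate of a user, $N_j\ge 0$ the number of users of a station of class $j\in\{F_c,\tilde F_c,R\}$, and $\rho'_j=N_j\xi L$ its traffic. The queueing model of a station with rate $\mathcal R$ and traffic $\rho'<\mathcal R$ has transmission time $L/\mathcal R$ and waiting time $\frac{L}{\mathcal R}\frac{\rho}{1-\rho}$ with $\rho=\rho'/\mathcal R$; write $q(\rho',\mathcal R)$ for their sum. For a constant $d>0$ let $D_{back}=d\,\rho'_{back}$ and $D_{front}=d\,\rho'_{front}$, where $\rho'_{back}$ and $\rho'_{front}$ are the mean total traffics of the stations of class $\tilde F_c$ and of class $R$. Put $\ell_{F_c}=0$, $\ell_{\tilde F_c}=D_{back}$, $\ell_R=D_{front}$. A station $x$ of class $j$ offers the latency $D_x=q(\rho'_j,R_x)+\ell_j$ if $\rho'_j<R_x$, and $D_x=\infty$ otherwise. \textbf{Association.} Let $\beta_j>\ell_j$ be latency targets. Under minimal-delay association the user is served by the station of minimal latency among the stations $x$ with $D_x<\beta_j$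 ($j$ the class of $x$), if there is one. The association probabilities are $$A_j=\frac{\mathbb P(\exists\, x \text{ of class } j:\ D_x<\beta_j)}{\mathbb P(\exists\, i,\ \exists\, x \text{ of class } i:\ D_x<\beta_i)} .$$ Let $\theta_j=2^{\rho'_j+L/(\beta_j-\ell_j)}-1$, the SINR above which $D_x<\beta_j$, and assume $\theta_{F_c}>1$, $\theta_{\tilde F_c}>1$ and $\theta_R>\zeta/\upsilon$. \textbf{Average latency.} Let $\mathbb E[R_F]$ (respectively $\mathbb E[R_R]$) be the average ergodic rate of F-AP users (RRH users): the expectation of the rate $R_x$ of the station $x$ of maximal reference signal receiving power $P r^{-\alpha}$, given that this station is an F-AP (an RRH). Assume stability: $\rho'_{F_c}<\mathbb E[R_F]$, $\rho'_{\tilde F_c}<\mathbb E[R_F]$, $\rho'_R<\mathbb E[R_R]$. The mean delivery latency at class $j$ is $\bar D_j=q(\rho'_j,\mathbb E[R_j])+\ell_j$, where $\mathbb E[R_{F_c}]=\mathbb E[R_{\tilde F_c}]=\mathbb E[R_F]$. The average delivery latency of the typical user is $D=\mathbb E[\bar D_J\mid\text{the user is served}]$, where $J$ is the class of the serving station. \textbf{Lemma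 7.} Under these assumptions $$D=A_{F_c}\frac{L}{\mathbb E[R_F]-\rho'_{F_c}}+A_{\tilde F_c}\left[\frac{L}{\mathbb E[R_F]-\rho'_{\tilde F_c}}+D_{back}\right]+A_R\left[\frac{L}{\mathbb E[R_R]-\rho'_R}+D_{front}\right].$$ -/

import Mathlib

noncomputable section

namespace FRAN

open MeasureTheory ProbabilityTheory

/-- The three classes of base stations seen by the typical user: F-APs that cache the requested
content, F-APs that do not, and RRHs. -/
inductive Tier
  | cached
  | uncached
  | rrh

/-- A base station is addressed by its class and its number inside the class. -/
abbrev Station := Tier × ℕ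

/-- The plane. -/
abbrev Plane := EuclideanSpace ℝ (Fin 2)

/-- The deterministic parameters of the network. -/
structure Params where
  /-- radius of the disc in which the base stations are deployed -/
  radius : ℝ
  /-- density of F-APs -/
  lamF : ℝ
  /-- density of RRHs -/
  lamR : ℝ
  /-- transmit power of F-APs -/
  PF : ℝ
  /-- transmit power of RRHs -/
  PR : ℝ
  /-- path loss exponent -/
  alpha : ℝ
  /-- noise variance -/
  sigma2 : ℝ
  /-- number of contents in the database -/
  numContents : ℕ
  /-- number of contents stored in each cache -/
  numCached : ℕ
  /-- Zipf exponent -/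
  tau : ℝ
  /-- content length -/
  len : ℝ
  /-- number of feedback bits -/
  feedbackBits : ℕ
  /-- number of antennas of an RRH -/
  antennas : ℕ
  /-- number of users served by a base station of the class -/
  load : Tier → ℝ
  /-- service request rate of a user -/
  xi : ℝ
  /-- proportionality constant between link traffic and link latency -/
  d : ℝ
  /-- latency targets -/
  beta : Tier → ℝ
  radius_pos : 0 < radius
  lamF_pos : 0 < lamF
  lamR_pos : 0 < lamR
  PF_pos : 0 < PF
  PR_pos : 0 < PR
  two_lt_alpha : 2 < alpha
  sigma2_pos : 0 < sigma2
  numCached_lt : numCached < numContents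
  tau_nonneg : 0 ≤ tau
  len_pos : 0 < len
  two_le_antennas : 2 ≤ antennas
  load_nonneg : ∀ j, 0 ≤ load j
  xi_pos : 0 < xi
  d_pos : 0 < d

namespace Params

variable (p : Params)

/-- Zipf popularity of the `i`-th most popular content. -/
def zipf (i : ℕ) : ℝ :=
  (1 / (i : ℝ) ^ p.tau) / ∑ j ∈ Finset.Icc 1 p.numContents, 1 / (j : ℝ) ^ p.tau

/-- Caching hit probability when the most popular contents are cached. -/
def pHit : ℝ := ∑ i ∈ Finset.Icc 1 p.numCached, p.zipf i

/-- Density of each class of base stations. -/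
def density : Tier → ℝ
  | .cached => p.pHit * p.lamF
  | .uncached => (1 - p.pHit) * p.lamF
  | .rrh => p.lamR

/-- Transmit power of each class. -/
def power : Tier → ℝ
  | .cached => p.PF
  | .uncached => p.PF
  | .rrh => p.PR

/-- Coefficient of the useful signal of an RRH under limited feedback: with the codebook size
`2 ^ B` and `m` antennas, `1 - 2 ^ B * Beta (2 ^ B, m / (m - 1))`. -/
def zeta : ℝ :=
  1 - (2 : ℝ) ^ p.feedbackBits *
    ProbabilityTheory.beta ((2 : ℝ) ^ p.feedbackBits) ((p.antennas : ℝ) / ((p.antennas : ℝ) - 1))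

/-- Coefficient of the residual interference among RRHs under limited feedback. -/
def upsilon : ℝ := (2 : ℝ) ^ (-((p.feedbackBits : ℝ) / ((p.antennas : ℝ) - 1)))

/-- Traffic of a base station of the class: number of users, times request rate, times content
length. -/
def traffic (j : Tier) : ℝ := p.load j * p.xi * p.len

end Params

/-- Queueing model of a base station: a content of length `len`, sent at rate `rate` by a station
with traffic `traffic` and hence traffic intensity `traffic / rate`, needs the transmission time
`len / rate` and the waiting time `(len / rate) * intensity / (1 - intensity)`.
Meaningful for `traffic < rate`. -/
def queueLatency (len traffic rate : ℝ) : ℝ :=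
  len / rate + len / rate * ((traffic / rate) / (1 - traffic / rate))

/-- The independent sources of randomness. -/
inductive Source
  | count (i : Tier)
  | pos (i : Tier) (k : ℕ)
  | gain (i : Tier) (k : ℕ)

/-- The information carried by a source of randomness. -/
@[reducible] def sourceSigma {Ω : Type*} (count : Tier → Ω → ℕ) (pos : Tier → ℕ → Ω → Plane)
    (gain : Tier → ℕ → Ω → ℝ) : Source → MeasurableSpace Ω
  | .count i => MeasurableSpace.comap (count i) inferInstance
  | .pos i k => MeasurableSpace.comap (pos i k) inferInstance
  | .gain i k => MeasurableSpace.comap (gain i k) inferInstance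

/-- The random network around the typical user at the origin. Each class of base stations is a
homogeneous Poisson point process on the disc: a Poisson number of points, placed independently and
uniformly; the classes are independent, and each station has an independent Rayleigh fading power
gain `|h|²`, exponentially distributed with mean one. -/
structure Network (p : Params) {Ω : Type*} [MeasurableSpace Ω] (P : Measure Ω) where
  /-- number of stations of the class; the stations are those numbered below it -/
  count : Tier → Ω → ℕ
  /-- positions of the stations -/
  pos : Tier → ℕ → Ω → Plane
  /-- fading power gains between the stations and the typical user -/
  gain : Tier → ℕ → Ω → ℝ
  measurable_count : ∀ i, Measurable (count i)
  measurable_pos : ∀ i k, Measurable (pos i k)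
  measurable_gain : ∀ i k, Measurable (gain i k)
  gain_nonneg : ∀ i k ω, 0 ≤ gain i k ω
  law_count : ∀ i, P.map (count i) =
    poissonMeasure (p.density i * (Real.pi * p.radius ^ 2)).toNNReal
  law_pos : ∀ i k, P.map (pos i k) =
    ProbabilityTheory.cond (volume : Measure Plane) (Metric.ball 0 p.radius)
  law_gain : ∀ i k, P.map (gain i k) = expMeasure 1
  indep : iIndep (sourceSigma count pos gain) P

namespace Network

variable {p : Params} {Ω : Type*} [MeasurableSpace Ω] {P : Measure Ω} (net : Network p P)

/-- The station `x` is present in the realization `ω`. -/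
def Present (ω : Ω) (x : Station) : Prop := x.2 < net.count x.1 ω

/-- Reference signal receiving power of `x` (no fading) at the typical user. -/
def rsrp (ω : Ω) (x : Station) : ℝ := p.power x.1 * ‖net.pos x.1 x.2 ω‖ ^ (-p.alpha)

/-- Instantaneous power received from `x`. -/
def signal (ω : Ω) (x : Station) : ℝ :=
  p.power x.1 * net.gain x.1 x.2 ω * ‖net.pos x.1 x.2 ω‖ ^ (-p.alpha)

open Classical in
/-- Total power received from all stations of class `i` other than `x`. -/
def othersPower (ω : Ω) (x : Station) (i : Tier) : ℝ :=
  ∑ k ∈ (Finset.range (net.count i ω)).filter (fun k => (i, k) ≠ x), net.signal ω (i, k)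

/-- Signal to interference plus noise ratio at the typical user when `x` serves it. -/
def sinr (ω : Ω) (x : Station) : ℝ :=
  match x.1 with
  | .rrh => p.zeta * net.signal ω x /
      (net.othersPower ω x .cached + net.othersPower ω x .uncached
        + p.upsilon * net.othersPower ω x .rrh + p.sigma2)
  | _ => net.signal ω x /
      (net.othersPower ω x .cached + net.othersPower ω x .uncached
        + net.othersPower ω x .rrh + p.sigma2)

/-- Instantaneous Shannon rate offered by `x`. -/
def rate (ω : Ω) (x : Station) : ℝ := Real.logb 2 (1 + net.sinr ω x)

/-- `x` is the station from which the typical user has the maximal RSRP. -/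
def IsStrongest (ω : Ω) (x : Station) : Prop :=
  net.Present ω x ∧ ∀ y, net.Present ω y → net.rsrp ω y ≤ net.rsrp ω x

open Classical in
/-- Average ergodic rate of the typical user at the classes in `T`: the mean rate offered by
the station of maximal RSRP, given that this station belongs to a class in `T`. -/
def ergodicRate (T : Set Tier) : ℝ :=
  ∫ ω, (if h : ∃ x, net.IsStrongest ω x ∧ x.1 ∈ T then net.rate ω h.choose else 0)
    ∂(ProbabilityTheory.cond P {ω | ∃ x, net.IsStrongest ω x ∧ x.1 ∈ T})

/-- `E[R_F]`, both kinds of F-APs together. -/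
def ergodicRateF : ℝ := net.ergodicRate {.cached, .uncached}

/-- `E[R_R]`. -/
def ergodicRateR : ℝ := net.ergodicRate {.rrh}

/-- Mean total traffic of the stations of class `i`. -/
def totalTraffic (i : Tier) : ℝ :=
  ∫ ω, ∑ _k ∈ Finset.range (net.count i ω), p.traffic i ∂P

/-- Latency of the backhaul links. -/
def dBack : ℝ := p.d * net.totalTraffic .uncached

/-- Latency of the fronthaul links. -/
def dFront : ℝ := p.d * net.totalTraffic .rrh

/-- Latency of the wired link through which the content reaches a station of the class. -/
def linkLatency : Tier → ℝ
  | .cached => 0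
  | .uncached => net.dBack
  | .rrh => net.dFront

open Classical in
/-- Instantaneous delivery latency offered by `x`; infinite when its queue is unstable. -/
def stationLatency (ω : Ω) (x : Station) : ENNReal :=
  if p.traffic x.1 < net.rate ω x then
    ENNReal.ofReal (queueLatency p.len (p.traffic x.1) (net.rate ω x) + net.linkLatency x.1)
  else ⊤

/-- `x` is present and its latency is below the target of its class. -/
def MeetsTarget (ω : Ω) (x : Station) : Prop :=
  net.Present ω x ∧ net.stationLatency ω x < ENNReal.ofReal (p.beta x.1)

/-- Minimal delay association: `x` has the minimal latency among the stations that meet the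
latency target of their class. -/
def IsServing (ω : Ω) (x : Station) : Prop :=
  net.MeetsTarget ω x ∧
    ∀ y, net.MeetsTarget ω y → net.stationLatency ω x ≤ net.stationLatency ω y

/-- SINR that a station of class `j` has to exceed in order to meet the latency target: its rate
must exceed `traffic + len / (target - link latency)`. -/
def sinrThreshold (j : Tier) : ℝ :=
  (2 : ℝ) ^ (p.traffic j + p.len / (p.beta j - net.linkLatency j)) - 1

/-- Minimal delay association probability of class `j`: the probability that some station of
class `j` meets its latency target, divided by the probability that some station does. -/
def assocProb (j : Tier) : ℝ :=
  P.real {ω | ∃ k, net.MeetsTarget ω (j, k)} / P.real {ω | ∃ x, net.MeetsTarget ω x}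

/-- Average ergodic rate at a class. -/
def tierRate : Tier → ℝ
  | .cached => net.ergodicRateF
  | .uncached => net.ergodicRateF
  | .rrh => net.ergodicRateR

/-- Mean delivery latency of a user served by class `j`: transmission and waiting time at the
average ergodic rate, plus the latency of the wired link. -/
def tierLatency (j : Tier) : ℝ :=
  queueLatency p.len (p.traffic j) (net.tierRate j) + net.linkLatency j

open Classical in
/-- Average delivery latency of the typical user under minimal delay association: the expectation
of the mean delivery latency at the class of the serving station, given that the user is
associated with a station. -/
def averageLatency : ℝ :=
  ∫ ω, (if h : ∃ x, net.IsServing ω x then net.tierLatency h.choose.1 else 0)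
    ∂(ProbabilityTheory.cond P {ω | ∃ x, net.IsServing ω x})

end Network

end FRAN

end

/-! Two stations of different classes are part of each other's interference: if `x` is received with
power `S x` over interference plus noise `I x`, then `S y ≤ I x` and `S x ≤ I y`, so the product of
`S x / I x` and `S y / I y` is at most one. Hence their SINRs cannot exceed thresholds whose product
is at least that of the coefficients of the useful signals (`1` for F-APs, `ζ` for RRHs), and the
events that class `j` has a station below its latency target are disjoint. As only finitely many
stations are present, the user is served exactly when one of these events occurs, and then by the
class to which it belongs; so the conditional expectation is the sum of the mean latencies weighted
by the conditional probabilities `A_j`. -/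

open MeasureTheory ProbabilityTheory

namespace FRAN

theorem map_add_map_add_sub_le_of_convexOn {E : Type*} [AddCommGroup E] [Module ℝ E] {S : Set E}
    {f : E → ℝ} (hf : ConvexOn ℝ S f) {x y z : E} (hx : x ∈ S) (hy : y ∈ S)
    (hz : z ∈ segment ℝ x y) : f z + f (x + y - z) ≤ f x + f y := by
  obtain ⟨a, b, ha, hb, hab, rfl⟩ := hz
  have hreflect : x + y - (a • x + b • y) = b • x + a • y := by
    rw [← eq_sub_iff_add_eq'] at hab
    subst hab
    module
  calc f (a • x + b • y) + f (x + y - (a • x + b • y))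
      ≤ (a • f x + b • f y) + (b • f x + a • f y) := by
        rw [hreflect]
        exact add_le_add (hf.2 hx hy ha hb hab) (hf.2 hx hy hb ha ((add_comm b a).trans hab))
    _ = (a + b) * (f x + f y) := by
        simp only [smul_eq_mul]
        ring
    _ = f x + f y := by rw [hab, one_mul]

theorem Gamma_mul_Gamma_le_Gamma_add_sub_one {s t : ℝ} (hs : 1 ≤ s) (ht : 1 ≤ t) :
    Real.Gamma s * Real.Gamma t ≤ Real.Gamma (s + t - 1) := by
  have hΓs : 0 < Real.Gamma s := Real.Gamma_pos_of_pos (by linarith)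
  have hΓt : 0 < Real.Gamma t := Real.Gamma_pos_of_pos (by linarith)
  have hΓ : 0 < Real.Gamma (s + t - 1) := Real.Gamma_pos_of_pos (by linarith)
  have hseg : s ∈ segment ℝ 1 (s + t - 1) := by
    rw [segment_eq_Icc (by linarith)]
    constructor <;> linarith
  rw [← Real.log_le_log_iff (mul_pos hΓs hΓt) hΓ, Real.log_mul hΓs.ne' hΓt.ne']
  have hlog := map_add_map_add_sub_le_of_convexOn Real.convexOn_log_Gamma
    (Set.mem_Ioi.2 one_pos) (Set.mem_Ioi.2 (by linarith)) hseg
  rw [show 1 + (s + t - 1) - s = t by ring] at hlog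
  simpa using hlog

theorem mul_beta_le_one {a b : ℝ} (ha : 0 < a) (hb : 1 ≤ b) :
    a * ProbabilityTheory.beta a b ≤ 1 := by
  have hΓ : 0 < Real.Gamma (a + b) := Real.Gamma_pos_of_pos (by linarith)
  rw [ProbabilityTheory.beta, ← mul_div_assoc, div_le_one hΓ, ← mul_assoc,
    ← Real.Gamma_add_one ha.ne']
  have hΓ_mul := Gamma_mul_Gamma_le_Gamma_add_sub_one (by linarith : 1 ≤ a + 1) hb
  rwa [add_right_comm, add_sub_cancel_right] at hΓ_mul

theorem queueLatency_eq_div_sub {len traffic rate : ℝ} (hrate : rate ≠ 0) (h : traffic ≠ rate) :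
    queueLatency len traffic rate = len / (rate - traffic) := by
  have hsub : rate - traffic ≠ 0 := sub_ne_zero.2 h.symm
  rw [queueLatency, one_sub_div hrate, div_div_div_cancel_right₀ hrate]
  field_simp
  ring

namespace Tier

instance : Fintype Tier where
  elems := ⟨{.cached, .uncached, .rrh}, by simp⟩
  complete j := by cases j <;> simp

theorem sum_univ {M : Type*} [AddCommMonoid M] (f : Tier → M) :
    ∑ j, f j = f .cached + f .uncached + f .rrh := by
  change Multiset.sum (Multiset.map f {.cached, .uncached, .rrh}) = _
  simp [add_assoc]

end Tier

namespace Params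

variable (p : Params)

theorem power_pos (j : Tier) : 0 < p.power j := by
  cases j
  exacts [p.PF_pos, p.PF_pos, p.PR_pos]

theorem traffic_nonneg (j : Tier) : 0 ≤ p.traffic j :=
  mul_nonneg (mul_nonneg (p.load_nonneg j) p.xi_pos.le) p.len_pos.le

theorem two_le_cast_antennas : (2 : ℝ) ≤ p.antennas := mod_cast p.two_le_antennas

theorem zeta_nonneg : 0 ≤ p.zeta := by
  have hm := p.two_le_cast_antennas
  refine sub_nonneg.2 (mul_beta_le_one (by positivity) ?_)
  rw [one_le_div (by linarith)]
  linarith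

theorem upsilon_pos : 0 < p.upsilon := Real.rpow_pos_of_pos two_pos _

theorem upsilon_le_one : p.upsilon ≤ 1 := by
  have hm := p.two_le_cast_antennas
  refine Real.rpow_le_one_of_one_le_of_nonpos one_le_two (neg_nonpos.2 ?_)
  exact div_nonneg (Nat.cast_nonneg _) (by linarith)

/-- The coefficient of the useful signal in the SINR of a station of the class. -/
noncomputable def signalCoeff : Tier → ℝ
  | .rrh => p.zeta
  | _ => 1

theorem signalCoeff_nonneg (j : Tier) : 0 ≤ p.signalCoeff j := by
  cases j
  exacts [zero_le_one, zero_le_one, p.zeta_nonneg]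

end Params

namespace Network

variable {p : Params} {Ω : Type*} [MeasurableSpace Ω] {P : Measure Ω} (net : Network p P)

section Interference

/-- The denominator of the SINR of `x`: the interference, in which limited feedback damps the other
RRHs if `x` is an RRH itself, plus the noise. -/
noncomputable def interferenceNoise (ω : Ω) (x : Station) : ℝ :=
  net.othersPower ω x .cached + net.othersPower ω x .uncached
    + (match x.1 with
      | .rrh => p.upsilon
      | _ => 1) * net.othersPower ω x .rrh + p.sigma2

theorem sinr_eq (ω : Ω) (x : Station) :
    net.sinr ω x = p.signalCoeff x.1 * net.signal ω x / net.interferenceNoise ω x := by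
  obtain ⟨_ | _ | _, k⟩ := x <;> simp [sinr, Params.signalCoeff, interferenceNoise]

theorem signal_nonneg (ω : Ω) (x : Station) : 0 ≤ net.signal ω x :=
  mul_nonneg (mul_nonneg (p.power_pos _).le (net.gain_nonneg _ _ _))
    (Real.rpow_nonneg (norm_nonneg _) _)

theorem othersPower_nonneg (ω : Ω) (x : Station) (i : Tier) : 0 ≤ net.othersPower ω x i :=
  Finset.sum_nonneg fun _ _ => net.signal_nonneg _ _

theorem interferenceNoise_nonneg (ω : Ω) (x : Station) : 0 ≤ net.interferenceNoise ω x := by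
  have ho := net.othersPower_nonneg ω x
  refine add_nonneg (add_nonneg (add_nonneg (ho _) (ho _)) (mul_nonneg ?_ (ho _))) p.sigma2_pos.le
  split
  exacts [p.upsilon_pos.le, zero_le_one]

theorem sinr_nonneg (ω : Ω) (x : Station) : 0 ≤ net.sinr ω x := by
  rw [sinr_eq]
  exact div_nonneg (mul_nonneg (p.signalCoeff_nonneg _) (net.signal_nonneg _ _))
    (net.interferenceNoise_nonneg _ _)

variable {net}

theorem Present.signal_le_othersPower {ω : Ω} {x y : Station} (hy : net.Present ω y)
    (hyx : y ≠ x) : net.signal ω y ≤ net.othersPower ω x y.1 := by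
  classical
  exact Finset.single_le_sum (f := fun k => net.signal ω (y.1, k))
    (fun _ _ => net.signal_nonneg _ _)
    (Finset.mem_filter.2 ⟨Finset.mem_range.2 hy, hyx⟩)

theorem Present.signal_le_interferenceNoise {ω : Ω} {x y : Station} (hy : net.Present ω y)
    (hyx : y.1 ≠ x.1) : net.signal ω y ≤ net.interferenceNoise ω x := by
  have ho := net.othersPower_nonneg ω x
  have hυ := mul_nonneg p.upsilon_pos.le (ho .rrh)
  have hσ := p.sigma2_pos
  refine (hy.signal_le_othersPower (ne_of_apply_ne Prod.fst hyx)).trans ?_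
  obtain ⟨i, k⟩ := x
  obtain ⟨j, l⟩ := y
  cases i <;> cases j <;> simp only [interferenceNoise, one_mul] <;>
    first
    | exact absurd rfl hyx
    | linarith [ho .cached, ho .uncached, ho .rrh]

theorem sinr_mul_sinr_le {ω : Ω} {x y : Station} (hx : net.Present ω x) (hy : net.Present ω y)
    (hxy : x.1 ≠ y.1) :
    net.sinr ω x * net.sinr ω y ≤ p.signalCoeff x.1 * p.signalCoeff y.1 := by
  have hx_div : net.signal ω x / net.interferenceNoise ω y ≤ 1 :=
    div_le_one_of_le₀ (hx.signal_le_interferenceNoise hxy) (net.interferenceNoise_nonneg _ _)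
  have hy_div : net.signal ω y / net.interferenceNoise ω x ≤ 1 :=
    div_le_one_of_le₀ (hy.signal_le_interferenceNoise hxy.symm) (net.interferenceNoise_nonneg _ _)
  calc net.sinr ω x * net.sinr ω y
      = p.signalCoeff x.1 * p.signalCoeff y.1 *
          (net.signal ω x / net.interferenceNoise ω y
            * (net.signal ω y / net.interferenceNoise ω x)) := by
        rw [sinr_eq, sinr_eq]
        ring
    _ ≤ p.signalCoeff x.1 * p.signalCoeff y.1 :=
        mul_le_of_le_one_right
          (mul_nonneg (p.signalCoeff_nonneg _) (p.signalCoeff_nonneg _))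
          (mul_le_one₀ hx_div
            (div_nonneg (net.signal_nonneg _ _) (net.interferenceNoise_nonneg _ _)) hy_div)

end Interference

section LatencyTarget

variable {net} {ω : Ω} {x y : Station}

theorem MeetsTarget.traffic_lt_rate (h : net.MeetsTarget ω x) :
    p.traffic x.1 < net.rate ω x := by
  by_contra hr
  have htop := h.2
  rw [stationLatency, if_neg hr] at htop
  exact not_top_lt htop

theorem MeetsTarget.len_div_sub_add_lt_beta (h : net.MeetsTarget ω x) :
    p.len / (net.rate ω x - p.traffic x.1) + net.linkLatency x.1 < p.beta x.1 := by
  have hr := h.traffic_lt_rate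
  have hlt := h.2
  rw [stationLatency, if_pos hr, queueLatency_eq_div_sub
    ((p.traffic_nonneg _).trans_lt hr).ne' hr.ne] at hlt
  exact (ENNReal.ofReal_lt_ofReal_iff'.1 hlt).1

theorem MeetsTarget.linkLatency_lt_beta (h : net.MeetsTarget ω x) :
    net.linkLatency x.1 < p.beta x.1 :=
  (lt_add_of_pos_left _ (div_pos p.len_pos (sub_pos.2 h.traffic_lt_rate))).trans
    h.len_div_sub_add_lt_beta

theorem sinrThreshold_pos {j : Tier} (hβ : net.linkLatency j < p.beta j) :
    0 < net.sinrThreshold j :=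
  sub_pos.2 <| Real.one_lt_rpow one_lt_two <|
    add_pos_of_nonneg_of_pos (p.traffic_nonneg j) (div_pos p.len_pos (sub_pos.2 hβ))

theorem MeetsTarget.sinrThreshold_lt_sinr (h : net.MeetsTarget ω x) :
    net.sinrThreshold x.1 < net.sinr ω x := by
  have hr := sub_pos.2 h.traffic_lt_rate
  have hβ := sub_pos.2 h.linkLatency_lt_beta
  have hrate : p.traffic x.1 + p.len / (p.beta x.1 - net.linkLatency x.1) < net.rate ω x := by
    rw [← lt_sub_iff_add_lt', div_lt_iff₀ hβ, ← div_lt_iff₀' hr]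
    exact lt_sub_iff_add_lt.2 h.len_div_sub_add_lt_beta
  rw [rate, Real.lt_logb_iff_rpow_lt one_lt_two
    (add_pos_of_pos_of_nonneg one_pos (net.sinr_nonneg ω x))] at hrate
  exact sub_lt_iff_lt_add'.2 hrate

theorem MeetsTarget.sinrThreshold_mul_lt (hx : net.MeetsTarget ω x) (hy : net.MeetsTarget ω y)
    (hxy : x.1 ≠ y.1) :
    net.sinrThreshold x.1 * net.sinrThreshold y.1 < p.signalCoeff x.1 * p.signalCoeff y.1 :=
  (mul_lt_mul'' hx.sinrThreshold_lt_sinr hy.sinrThreshold_lt_sinr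
    (sinrThreshold_pos hx.linkLatency_lt_beta).le
    (sinrThreshold_pos hy.linkLatency_lt_beta).le).trans_le
    (sinr_mul_sinr_le hx.1 hy.1 hxy)

theorem MeetsTarget.tier_eq
    (hθ : Pairwise fun i j =>
      p.signalCoeff i * p.signalCoeff j ≤ net.sinrThreshold i * net.sinrThreshold j)
    (hx : net.MeetsTarget ω x) (hy : net.MeetsTarget ω y) : x.1 = y.1 := by
  by_contra hxy
  exact (hx.sinrThreshold_mul_lt hy hxy).not_ge (hθ hxy)

end LatencyTarget

theorem pairwise_signalCoeff_mul_le_sinrThreshold_mul (hθc : 1 ≤ net.sinrThreshold .cached)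
    (hθu : 1 ≤ net.sinrThreshold .uncached)
    (hθR : p.zeta / p.upsilon ≤ net.sinrThreshold .rrh) :
    Pairwise fun i j =>
      p.signalCoeff i * p.signalCoeff j ≤ net.sinrThreshold i * net.sinrThreshold j := by
  have hζ : p.zeta ≤ p.zeta / p.upsilon :=
    le_div_self p.zeta_nonneg p.upsilon_pos p.upsilon_le_one
  have hθ (j : Tier) : p.signalCoeff j ≤ net.sinrThreshold j := by
    cases j
    exacts [hθc, hθu, hζ.trans hθR]
  exact fun i j _ => mul_le_mul (hθ i) (hθ j) (p.signalCoeff_nonneg j)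
    ((p.signalCoeff_nonneg i).trans (hθ i))

theorem finite_setOf_present (ω : Ω) : {x | net.Present ω x}.Finite := by
  refine (Set.finite_iUnion fun i : Tier =>
    (Set.finite_Iio (net.count i ω)).image (Prod.mk i)).subset fun x hx => ?_
  exact Set.mem_iUnion.2 ⟨x.1, x.2, hx, rfl⟩

theorem exists_isServing_iff_exists_meetsTarget {ω : Ω} :
    (∃ x, net.IsServing ω x) ↔ ∃ x, net.MeetsTarget ω x := by
  refine ⟨fun ⟨x, hx⟩ => ⟨x, hx.1⟩, fun hne => ?_⟩
  exact Set.exists_min_image {x | net.MeetsTarget ω x} (net.stationLatency ω)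
    ((net.finite_setOf_present ω).subset fun _ hx => hx.1) hne

section Measurability

theorem measurable_signal (x : Station) : Measurable fun ω => net.signal ω x :=
  ((net.measurable_gain _ _).const_mul _).mul ((net.measurable_pos _ _).norm.pow_const _)

theorem measurable_othersPower (x : Station) (i : Tier) :
    Measurable fun ω => net.othersPower ω x i := by
  classical
  have h : Measurable fun q : ℕ × Ω =>
      ∑ k ∈ (Finset.range q.1).filter (fun k => (i, k) ≠ x), net.signal q.2 (i, k) :=
    measurable_from_prod_countable_right fun n =>
      Finset.measurable_sum ((Finset.range n).filter fun k => (i, k) ≠ x)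
        fun k _ => net.measurable_signal (i, k)
  convert h.comp ((net.measurable_count i).prodMk measurable_id) using 1
  funext ω
  simp only [othersPower, Function.comp_apply, id]

theorem measurable_sinr (x : Station) : Measurable fun ω => net.sinr ω x := by
  have ho := net.measurable_othersPower x
  simp only [sinr_eq, interferenceNoise]
  exact ((net.measurable_signal x).const_mul _).div
    ((((ho _).add (ho _)).add ((ho _).const_mul _)).add_const _)

theorem measurable_rate (x : Station) : Measurable fun ω => net.rate ω x :=
  (Real.measurable_log.comp ((net.measurable_sinr x).const_add 1)).div_const _

theorem measurable_stationLatency (x : Station) :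
    Measurable fun ω => net.stationLatency ω x := by
  have hr := net.measurable_rate x
  unfold stationLatency queueLatency
  exact Measurable.ite (measurableSet_lt measurable_const hr) (by fun_prop) measurable_const

theorem measurableSet_meetsTarget (x : Station) : MeasurableSet {ω | net.MeetsTarget ω x} :=
  (measurableSet_lt measurable_const (net.measurable_count x.1)).inter
    (measurableSet_lt (net.measurable_stationLatency x) measurable_const)

end Measurability

section Association

/-- The event that some station of class `j` meets its latency target; `assocProb j` is the
conditional probability of this event given `⋃ i, net.tierMeetsTarget i`. -/
def tierMeetsTarget (j : Tier) : Set Ω := {ω | ∃ k, net.MeetsTarget ω (j, k)}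

theorem measurableSet_tierMeetsTarget (j : Tier) : MeasurableSet (net.tierMeetsTarget j) := by
  rw [tierMeetsTarget, Set.ofPred_exists]
  exact MeasurableSet.iUnion fun k => net.measurableSet_meetsTarget (j, k)

theorem setOf_exists_meetsTarget :
    {ω | ∃ x, net.MeetsTarget ω x} = ⋃ j, net.tierMeetsTarget j := by
  ext ω
  simp [tierMeetsTarget, Prod.exists]

theorem cond_real_tierMeetsTarget (j : Tier) :
    (ProbabilityTheory.cond P (⋃ i, net.tierMeetsTarget i)).real (net.tierMeetsTarget j) =
      net.assocProb j := by
  have hm : MeasurableSet (⋃ i, net.tierMeetsTarget i) :=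
    MeasurableSet.iUnion net.measurableSet_tierMeetsTarget
  rw [measureReal_def, cond_apply hm, Set.inter_eq_self_of_subset_right
    (Set.subset_iUnion net.tierMeetsTarget j), ENNReal.toReal_mul, ENNReal.toReal_inv, assocProb,
    setOf_exists_meetsTarget, div_eq_inv_mul]
  rfl

variable {net}

open Classical in
theorem tierLatency_serving_eq_sum_indicator {ω : Ω}
    (hω : ∀ x y, net.MeetsTarget ω x → net.MeetsTarget ω y → x.1 = y.1) :
    (if h : ∃ x, net.IsServing ω x then net.tierLatency h.choose.1 else 0) =
      ∑ j, (net.tierMeetsTarget j).indicator (fun _ => net.tierLatency j) ω := by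
  split_ifs with h
  · have hserve : net.MeetsTarget ω h.choose := h.choose_spec.1
    have hmem : ω ∈ net.tierMeetsTarget h.choose.1 := ⟨_, hserve⟩
    rw [Fintype.sum_eq_single h.choose.1, Set.indicator_of_mem hmem]
    intro j hj
    have hnot : ω ∉ net.tierMeetsTarget j := fun ⟨k, hk⟩ => hj (hω (j, k) _ hk hserve)
    exact Set.indicator_of_notMem hnot _
  · have hnot (j : Tier) : ω ∉ net.tierMeetsTarget j := fun ⟨k, hk⟩ =>
      h (net.exists_isServing_iff_exists_meetsTarget.2 ⟨(j, k), hk⟩)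
    exact (Finset.sum_eq_zero fun j _ => Set.indicator_of_notMem (hnot j) _).symm

theorem averageLatency_eq_sum_assocProb_mul
    (hexcl : ∀ ω x y, net.MeetsTarget ω x → net.MeetsTarget ω y → x.1 = y.1) :
    net.averageLatency = ∑ j, net.assocProb j * net.tierLatency j := by
  have hserved : {ω | ∃ x, net.IsServing ω x} = ⋃ j, net.tierMeetsTarget j := by
    simp only [exists_isServing_iff_exists_meetsTarget, setOf_exists_meetsTarget]
  have hmeas := net.measurableSet_tierMeetsTarget
  simp only [averageLatency, tierLatency_serving_eq_sum_indicator (hexcl _), hserved]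
  rw [integral_finsetSum _ fun j _ => (integrable_const _).indicator (hmeas j)]
  simp only [integral_indicator_const _ (hmeas _), cond_real_tierMeetsTarget, smul_eq_mul]

variable (net)

theorem tierLatency_eq {j : Tier} (hρ : p.traffic j < net.tierRate j) :
    net.tierLatency j = p.len / (net.tierRate j - p.traffic j) + net.linkLatency j := by
  rw [tierLatency, queueLatency_eq_div_sub ((p.traffic_nonneg j).trans_lt hρ).ne' hρ.ne]

end Association

end Network

end FRAN

theorem lemma7_general {Ω : Type*} [MeasurableSpace Ω] (P : MeasureTheory.Measure Ω)
    (p : FRAN.Params) (net : FRAN.Network p P)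
    (hθ : Pairwise fun i j =>
      p.signalCoeff i * p.signalCoeff j ≤ net.sinrThreshold i * net.sinrThreshold j)
    (hρc : p.traffic .cached < net.ergodicRateF)
    (hρu : p.traffic .uncached < net.ergodicRateF)
    (hρR : p.traffic .rrh < net.ergodicRateR) :
    net.averageLatency =
      net.assocProb .cached * (p.len / (net.ergodicRateF - p.traffic .cached))
      + net.assocProb .uncached *
          (p.len / (net.ergodicRateF - p.traffic .uncached) + net.dBack)
      + net.assocProb .rrh *
          (p.len / (net.ergodicRateR - p.traffic .rrh) + net.dFront) := by
  rw [FRAN.Network.averageLatency_eq_sum_assocProb_mul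
      fun _ _ _ => FRAN.Network.MeetsTarget.tier_eq hθ,
    FRAN.Tier.sum_univ, net.tierLatency_eq hρc, net.tierLatency_eq hρu, net.tierLatency_eq hρR]
  simp only [FRAN.Network.tierRate, FRAN.Network.linkLatency, add_zero]

theorem lemma7 {Ω : Type*} [MeasurableSpace Ω] (P : MeasureTheory.Measure Ω)
    [MeasureTheory.IsProbabilityMeasure P] (p : FRAN.Params) (net : FRAN.Network p P)
    (hβ : ∀ j, net.linkLatency j < p.beta j)
    (hθc : 1 < net.sinrThreshold .cached)
    (hθu : 1 < net.sinrThreshold .uncached)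
    (hθR : p.zeta / p.upsilon < net.sinrThreshold .rrh)
    (hρc : p.traffic .cached < net.ergodicRateF)
    (hρu : p.traffic .uncached < net.ergodicRateF)
    (hρR : p.traffic .rrh < net.ergodicRateR) :
    net.averageLatency =
      net.assocProb .cached * (p.len / (net.ergodicRateF - p.traffic .cached))
      + net.assocProb .uncached *
          (p.len / (net.ergodicRateF - p.traffic .uncached) + net.dBack)
      + net.assocProb .rrh *
          (p.len / (net.ergodicRateR - p.traffic .rrh) + net.dFront) := by
  exact lemma7_general P p net
    (net.pairwise_signalCoeff_mul_le_sinrThreshold_mul hθc.le hθu.le hθR.le) hρc hρu hρR
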